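/- Let $N,m,n,s\in\mathbb{N}$, let $f_1,\dots,f_N:\mathbb{R}\times\mathbb{R}\to\mathbb{R}$ be twice continuously differentiable, let $a_i\in\mathbb{R}^m$, $b_i\in\mathbb{R}^n$ $(1\le i\le N)$, and let $$f(x,y)=\frac1N\sum_{i=1}^N \tilde f_i(x,y),\qquad \tilde f_i(x,y)=f_i(a_i^\top x,\,b_i^\top y),\qquad (x,y)\in\mathbb{R}^m\times\mathbb{R}^n .$$ Vectors carry the $\ell_2$-norm and Hessians the operator norm; $f_i''\in\mathbb{R}^{2\times2}$ is the Hessian of $f_i$. Put $w_i(x,y)=\|f_i''(a_i^\top x,b_i^\top y)\|\,(\|a_i\|^2+\|b_i\|^2)$, and suppose that $B_1,\dots,B_N\in\mathbb{R}$ satisfy $$\sup_{(x,y)\in\mathbb{R}^m\times\mathbb{R}^n} w_i(x,y)\le B_i\quad\text{for all } i,\qquad B_{\mathrm{avg}}=\frac1N\sum_{i=1}^N B_i .$$ Let $0<\tau<1$ and $0<\delta<1$. Fix $z=(x,y)$ with $\sum_{j}w_j(z)>0$ and let $p_i=w_i(z)/\sum_{j=1}^N w_j(z)$. Let $\xi_1,\dots,\xi_s$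 be independent random indices in $\{1,\dots,N\}$ with $\mathrm{Prob}(\xi_j=i)=p_i$ for all $i$ and $j$ (sampling with replacement), and let $$H(z)=\frac{1}{Ns}\sum_{j=1}^{s}\frac{1}{p_{\xi_j}}\nabla^2\tilde f_{\xi_j}(z)$$ be the subsampled Hessian (indices with $p_i=0$ are almost surely never drawn). If the sample size satisfies $$s\;\ge\;\frac{4B_{\mathrm{avg}}^2}{\tau^2}\,\log\!\left(\frac{2(m+n)}{\delta}\right),$$ then $$\mathrm{Prob}\big(\|H(z)-\nabla^2 f(z)\|\le\tau\big)\ \ge\ 1-\delta .$$ -/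

import Mathlib

open MeasureTheory ProbabilityTheory

noncomputable section

/-- The Hessian `∇²g(x, y)` of a function `g(x, y)` of two vector variables, as the linear operator
on the Euclidean product space of all `(x, y)` that is the derivative of the full gradient of `g`.
Its norm is the operator (spectral) norm with respect to the `ℓ₂`-norm. -/
def fullHessian {E F : Type*}
    [NormedAddCommGroup E] [InnerProductSpace ℝ E] [CompleteSpace E]
    [NormedAddCommGroup F] [InnerProductSpace ℝ F] [CompleteSpace F]
    (g : E → F → ℝ) (x : E) (y : F) : WithLp 2 (E × F) →L[ℝ] WithLp 2 (E × F) :=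
  fderiv ℝ (fun w : WithLp 2 (E × F) =>
    gradient (fun z : WithLp 2 (E × F) => g z.fst z.snd) w) (WithLp.toLp 2 (x, y))

/-- The summand `(x, y) ↦ φ (aᵀx, bᵀy)`. -/
def ridge {m n : ℕ} (φ : ℝ → ℝ → ℝ) (a : EuclideanSpace ℝ (Fin m)) (b : EuclideanSpace ℝ (Fin n))
    (x : EuclideanSpace ℝ (Fin m)) (y : EuclideanSpace ℝ (Fin n)) : ℝ :=
  φ (inner ℝ a x) (inner ℝ b y)

/-- The finite-sum objective `f(x, y) = (1/N) ∑ᵢ fᵢ(aᵢᵀx, bᵢᵀy)`. -/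
def finiteSum {N m n : ℕ} (f : Fin N → ℝ → ℝ → ℝ)
    (a : Fin N → EuclideanSpace ℝ (Fin m)) (b : Fin N → EuclideanSpace ℝ (Fin n))
    (x : EuclideanSpace ℝ (Fin m)) (y : EuclideanSpace ℝ (Fin n)) : ℝ :=
  (1 / (N : ℝ)) * ∑ i, ridge (f i) (a i) (b i) x y

/-- The quantity `‖φ''(aᵀx, bᵀy)‖ (‖a‖² + ‖b‖²)`, where `φ''` is the `2 × 2` Hessian of `φ`. -/
def hessWeight {m n : ℕ} (φ : ℝ → ℝ → ℝ)
    (a : EuclideanSpace ℝ (Fin m)) (b : EuclideanSpace ℝ (Fin n))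
    (x : EuclideanSpace ℝ (Fin m)) (y : EuclideanSpace ℝ (Fin n)) : ℝ :=
  ‖fullHessian φ (inner ℝ a x) (inner ℝ b y)‖ * (‖a‖ ^ 2 + ‖b‖ ^ 2)

/-- The nonuniform sampling probabilities `pᵢ` at the point `(x, y)`. -/
def samplingProb {N m n : ℕ} (f : Fin N → ℝ → ℝ → ℝ)
    (a : Fin N → EuclideanSpace ℝ (Fin m)) (b : Fin N → EuclideanSpace ℝ (Fin n))
    (x : EuclideanSpace ℝ (Fin m)) (y : EuclideanSpace ℝ (Fin n)) (i : Fin N) : ℝ :=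
  hessWeight (f i) (a i) (b i) x y / ∑ j, hessWeight (f j) (a j) (b j) x y

/-- The subsampled Hessian `(1/(N s)) ∑_{j < s} (1/p_{ξⱼ}) ∇²f_{ξⱼ}(x, y)` formed from a sample
`ξ₁, …, ξₛ` of indices (a list, so repeated indices are counted with multiplicity). -/
def subsampledHessian {N m n s : ℕ} (f : Fin N → ℝ → ℝ → ℝ)
    (a : Fin N → EuclideanSpace ℝ (Fin m)) (b : Fin N → EuclideanSpace ℝ (Fin n))
    (p : Fin N → ℝ) (ξ : Fin s → Fin N)
    (x : EuclideanSpace ℝ (Fin m)) (y : EuclideanSpace ℝ (Fin n)) :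
    WithLp 2 (EuclideanSpace ℝ (Fin m) × EuclideanSpace ℝ (Fin n)) →L[ℝ]
      WithLp 2 (EuclideanSpace ℝ (Fin m) × EuclideanSpace ℝ (Fin n)) :=
  (1 / ((N : ℝ) * (s : ℝ))) •
    ∑ j, (1 / p (ξ j)) • fullHessian (ridge (f (ξ j)) (a (ξ j)) (b (ξ j))) x y

end

/-! With `p i` proportional to the weights `w i`, the operators `X i = (1 / (N * p i)) • H i`, where
`H i` is the Hessian of the `i`-th summand, are self-adjoint and average to the full Hessian. Since
`‖H i‖ ≤ w i`, they share the norm bound `W = (1 / N) * ∑ w ≤ Bavg`. The theorem is thus a matrix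
Chernoff bound for the mean of `s` independent draws (`sum_prod_filter_lt_norm_le`).

That bound follows Ahlswede and Winter. If the mean deviates by more than `τ`, then `tr exp (θS) +
tr exp (-θS)` is at least `exp (θsτ)`, where `S` is the centred sum. Golden–Thompson
(`trace_exp_add_le`) peels off one draw at a time, and each draw costs a factor `exp (θ²W²)`
(`sum_mul_inner_exp_le`). The failure probability is at most `2(m+n) exp (sθ²W² - θsτ)`, and `θ =
τ/(2W²)` turns the exponent into `-sτ²/(4W²)`.

Golden–Thompson itself combines the Lie product formula with `tr ((pq)^(2^k)) ≤ tr (p^(2^k)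
q^(2^k))` for self-adjoint `p`, `q`. -/

section LieProduct

/-! ### The Lie product formula -/

open Filter Topology

theorem norm_pow_sub_pow_le {A : Type*} [NormedRing A] [NormOneClass A] {x y : A} {M : ℝ}
    (hM : 1 ≤ M) (hx : ‖x‖ ≤ M) (hy : ‖y‖ ≤ M) (n : ℕ) :
    ‖x ^ n - y ^ n‖ ≤ n * M ^ n * ‖x - y‖ := by
  have h0 : 0 ≤ M := zero_le_one.trans hM
  induction n with
  | zero => simp
  | succ n ih =>
    have h1 : x ^ (n + 1) - y ^ (n + 1) = x ^ n * (x - y) + (x ^ n - y ^ n) * y := by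
      rw [pow_succ, pow_succ]; noncomm_ring
    have h2 : ‖x ^ n * (x - y)‖ ≤ M ^ (n + 1) * ‖x - y‖ := by
      refine (norm_mul_le _ _).trans ?_
      gcongr
      calc ‖x ^ n‖ ≤ ‖x‖ ^ n := norm_pow_le x n
        _ ≤ M ^ n := by gcongr
        _ ≤ M ^ (n + 1) := pow_le_pow_right₀ hM n.le_succ
    have h3 : ‖(x ^ n - y ^ n) * y‖ ≤ n * M ^ n * ‖x - y‖ * M := by
      refine (norm_mul_le _ _).trans ?_
      gcongr
    rw [h1]
    refine (norm_add_le _ _).trans ((add_le_add h2 h3).trans (le_of_eq ?_))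
    push_cast
    ring

/-- Two differentiable curves through `1` with the same velocity have the same limit of
`n`-th powers at time `1 / n`. -/
theorem tendsto_pow_sub_pow_of_hasDerivAt {A : Type*} [NormedRing A] [NormedAlgebra ℝ A]
    [NormOneClass A] {g h : ℝ → A} {c : A} (hg : HasDerivAt g c 0) (hh : HasDerivAt h c 0)
    (hg0 : g 0 = 1) (hh0 : h 0 = 1) :
    Tendsto (fun n : ℕ => g (n : ℝ)⁻¹ ^ n - h (n : ℝ)⁻¹ ^ n) atTop (𝓝 0) := by
  have hinv : Tendsto (fun n : ℕ => (n : ℝ)⁻¹) atTop (𝓝[≠] 0) := by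
    refine tendsto_nhdsWithin_iff.2 ⟨tendsto_inv_atTop_nhds_zero_nat, ?_⟩
    filter_upwards [eventually_gt_atTop 0] with n hn
    have : (0 : ℝ) < n := by exact_mod_cast hn
    exact (inv_pos.2 this).ne'
  -- This keeps the `n`-th powers bounded by `exp (‖c‖ + 1)`, so the telescoping estimate leaves
  -- only `n • (g - h)` at `1 / n`, which tends to the derivative of `g - h` at `0`, namely `0`.
  have hbound : ∀ f : ℝ → A, HasDerivAt f c 0 → f 0 = 1 →
      ∀ᶠ n : ℕ in atTop, ‖f (n : ℝ)⁻¹‖ ≤ Real.exp ((‖c‖ + 1) * (n : ℝ)⁻¹) := by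
    intro f hf hf0
    have h1 := (hasDerivAt_iff_tendsto_slope_zero.1 hf).norm.comp hinv
    filter_upwards [h1.eventually_le_const (lt_add_one ‖c‖), eventually_gt_atTop 0] with n hn hn0
    have hn0' : (0 : ℝ) < n := by exact_mod_cast hn0
    simp only [Function.comp, zero_add, hf0, inv_inv, norm_smul, Real.norm_natCast] at hn
    have h2 : ‖f (n : ℝ)⁻¹ - 1‖ ≤ (‖c‖ + 1) * (n : ℝ)⁻¹ := by
      rw [← div_eq_mul_inv, le_div_iff₀ hn0']; linarith
    calc ‖f (n : ℝ)⁻¹‖ = ‖(f (n : ℝ)⁻¹ - 1) + 1‖ := by rw [sub_add_cancel]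
      _ ≤ ‖f (n : ℝ)⁻¹ - 1‖ + ‖(1 : A)‖ := norm_add_le _ _
      _ ≤ (‖c‖ + 1) * (n : ℝ)⁻¹ + 1 := by rw [norm_one]; linarith
      _ ≤ _ := Real.add_one_le_exp _
  have hlim : Tendsto (fun n : ℕ => Real.exp (‖c‖ + 1) *
      ‖(n : ℝ) • (g (n : ℝ)⁻¹ - h (n : ℝ)⁻¹)‖) atTop (𝓝 0) := by
    have h1 := (hasDerivAt_iff_tendsto_slope_zero.1 (hg.sub hh)).norm.comp hinv
    have h2 := h1.const_mul (Real.exp (‖c‖ + 1))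
    simpa [Function.comp_def, hg0, hh0] using h2
  refine squeeze_zero_norm' ?_ hlim
  filter_upwards [hbound g hg hg0, hbound h hh hh0, eventually_gt_atTop 0] with n h1 h2 hn0
  have hn0' : (0 : ℝ) < n := by exact_mod_cast hn0
  have h3 := norm_pow_sub_pow_le (Real.one_le_exp (by positivity)) h1 h2 n
  refine h3.trans (le_of_eq ?_)
  rw [← Real.exp_nat_mul, norm_smul, Real.norm_natCast, mul_left_comm (n : ℝ),
    mul_inv_cancel₀ hn0'.ne', mul_one]
  ring

/-- The **Lie product formula**. -/
theorem tendsto_exp_mul_exp_pow {A : Type*} [NormedRing A] [NormedAlgebra ℝ A]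
    [NormOneClass A] [CompleteSpace A] (a b : A) :
    Tendsto (fun n : ℕ => (NormedSpace.exp ((n : ℝ)⁻¹ • a) *
      NormedSpace.exp ((n : ℝ)⁻¹ • b)) ^ n) atTop (𝓝 (NormedSpace.exp (a + b))) := by
  let _ : NormedAlgebra ℚ A := NormedAlgebra.restrictScalars ℚ ℝ A
  have hd : ∀ x : A, HasDerivAt (fun t : ℝ => NormedSpace.exp (t • x)) x 0 := fun x => by
    simpa using hasDerivAt_exp_smul_const x (0 : ℝ)
  have hg : HasDerivAt (fun t : ℝ => NormedSpace.exp (t • a) * NormedSpace.exp (t • b))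
      (a + b) 0 := by
    have h := (hd a).fun_mul (hd b)
    simpa using h
  have h := tendsto_pow_sub_pow_of_hasDerivAt hg (hd (a + b)) (by simp) (by simp)
  have h2 := h.add_const (NormedSpace.exp (a + b))
  rw [zero_add] at h2
  refine h2.congr' ?_
  filter_upwards [eventually_gt_atTop 0] with n hn0
  have hn0' : (n : ℝ) ≠ 0 := by exact_mod_cast hn0.ne'
  rw [← NormedSpace.exp_nsmul, ← Nat.cast_smul_eq_nsmul ℝ, smul_smul, mul_inv_cancel₀ hn0',
    one_smul, sub_add_cancel]

end LieProduct

/-! ### Trace inequalities and Golden–Thompson -/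

section Tracial

variable {A : Type*} [Ring A] [Algebra ℝ A] {tr : A →ₗ[ℝ] ℝ}

theorem trace_mul_pow_comm (hcomm : ∀ a b, tr (a * b) = tr (b * a)) (a b : A) (n : ℕ) :
    tr ((a * b) ^ n) = tr ((b * a) ^ n) := by
  cases n with
  | zero => simp
  | succ n => rw [pow_succ', mul_assoc, hcomm, mul_assoc, mul_pow_mul, ← mul_assoc, ← pow_succ']

variable [StarRing A]

/-- A positive tracial functional satisfies `tr (z²) ≤ tr (z z⋆)`. -/
theorem trace_mul_self_le (hcomm : ∀ a b, tr (a * b) = tr (b * a))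
    (hstar : ∀ a, tr (star a) = tr a) (hpos : ∀ a, 0 ≤ tr (a * star a)) (z : A) :
    tr (z * z) ≤ tr (z * star z) := by
  have h := hpos (z - star z)
  have h1 : (z - star z) * star (z - star z)
      = z * star z - z * z - star z * star z + star z * z := by
    simp; noncomm_ring
  have h2 : tr (star z * star z) = tr (z * z) := by rw [← star_mul, hstar]
  rw [h1, map_add, map_sub, map_sub, hcomm (star z) z, h2] at h
  linarith

theorem two_mul_trace_mul_le (hcomm : ∀ a b, tr (a * b) = tr (b * a))
    (hpos : ∀ a, 0 ≤ tr (a * star a)) {p q : A} (hp : IsSelfAdjoint p) (hq : IsSelfAdjoint q) :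
    2 * tr (p * q) ≤ tr (p * p) + tr (q * q) := by
  have h := hpos (p - q)
  have h1 : (p - q) * star (p - q) = p * p - p * q - q * p + q * q := by
    rw [star_sub, hp.star_eq, hq.star_eq]; noncomm_ring
  rw [h1, map_add, map_sub, map_sub, hcomm q p] at h
  linarith

/-- The two claims feed each other. For the first, apply it one level down to `z²`, rotate
cyclically to a product of `z z⋆` and `z⋆ z`, split by the second claim, and finish with
`two_mul_trace_mul_le`. The second follows from the first at `z = pq`, a rotation to `p² q²`, and
the second one level down. -/
theorem trace_pow_two_pow_le (hcomm : ∀ a b, tr (a * b) = tr (b * a))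
    (hstar : ∀ a, tr (star a) = tr a) (hpos : ∀ a, 0 ≤ tr (a * star a)) (k : ℕ) :
    (∀ z, tr (z ^ 2 ^ (k + 1)) ≤ tr ((z * star z) ^ 2 ^ k)) ∧
    (∀ p q, IsSelfAdjoint p → IsSelfAdjoint q →
      tr ((p * q) ^ 2 ^ k) ≤ tr (p ^ 2 ^ k * q ^ 2 ^ k)) := by
  induction k with
  | zero => exact ⟨fun z => by simpa [pow_two] using trace_mul_self_le hcomm hstar hpos z,
      fun p q _ _ => by simp⟩
  | succ k ih =>
    obtain ⟨ih₁, ih₂⟩ := ih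
    refine ⟨fun z => ?_, fun p q hp hq => ?_⟩
    · have hp : IsSelfAdjoint (star z * z) := .star_mul_self z
      have hq : IsSelfAdjoint (z * star z) := .mul_star_self z
      calc tr (z ^ 2 ^ (k + 1 + 1)) = tr ((z * z) ^ 2 ^ (k + 1)) := by
            rw [← pow_two, ← pow_mul, pow_succ' 2 (k + 1)]
        _ ≤ tr ((z * z * star (z * z)) ^ 2 ^ k) := ih₁ _
        _ = tr ((z * (z * star z * star z)) ^ 2 ^ k) := by
            rw [star_mul]; noncomm_ring
        _ = tr (((z * star z) * (star z * z)) ^ 2 ^ k) := by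
            rw [trace_mul_pow_comm hcomm]; noncomm_ring
        _ ≤ tr ((z * star z) ^ 2 ^ k * (star z * z) ^ 2 ^ k) := ih₂ _ _ hq hp
        _ ≤ tr ((z * star z) ^ 2 ^ (k + 1)) := by
            have h := two_mul_trace_mul_le hcomm hpos (hq.pow (2 ^ k)) (hp.pow (2 ^ k))
            rw [← pow_add, ← pow_add, ← two_mul, ← pow_succ',
              trace_mul_pow_comm hcomm (star z)] at h
            linarith
    · calc tr ((p * q) ^ 2 ^ (k + 1)) ≤ tr ((p * q * star (p * q)) ^ 2 ^ k) := ih₁ _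
        _ = tr ((p * (q * q * p)) ^ 2 ^ k) := by
            rw [star_mul, hp.star_eq, hq.star_eq]; noncomm_ring
        _ = tr (((q * q) * (p * p)) ^ 2 ^ k) := by
            rw [trace_mul_pow_comm hcomm]; noncomm_ring
        _ = tr (((p ^ 2) * (q ^ 2)) ^ 2 ^ k) := by
            rw [trace_mul_pow_comm hcomm, pow_two, pow_two]
        _ ≤ tr ((p ^ 2) ^ 2 ^ k * (q ^ 2) ^ 2 ^ k) := ih₂ _ _ (hp.pow 2) (hq.pow 2)
        _ = tr (p ^ 2 ^ (k + 1) * q ^ 2 ^ (k + 1)) := by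
            rw [← pow_mul, ← pow_mul, ← pow_succ']

end Tracial

open Filter Topology in
/-- The **Golden–Thompson inequality** for a continuous positive tracial functional. -/
theorem trace_exp_add_le {A : Type*} [NormedRing A] [NormedAlgebra ℝ A] [NormOneClass A]
    [CompleteSpace A] [StarRing A] [StarModule ℝ A] [ContinuousStar A] {tr : A →ₗ[ℝ] ℝ}
    (hcont : Continuous tr) (hcomm : ∀ a b, tr (a * b) = tr (b * a))
    (hstar : ∀ a, tr (star a) = tr a) (hpos : ∀ a, 0 ≤ tr (a * star a))
    {a b : A} (ha : IsSelfAdjoint a) (hb : IsSelfAdjoint b) :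
    tr (NormedSpace.exp (a + b)) ≤ tr (NormedSpace.exp a * NormedSpace.exp b) := by
  let _ : NormedAlgebra ℚ A := NormedAlgebra.restrictScalars ℚ ℝ A
  -- Only exponents `2^k` are covered by the trace inequality, so the Lie limit is taken along that
  -- subsequence.
  have h1 := (hcont.tendsto _).comp ((tendsto_exp_mul_exp_pow a b).comp
    (tendsto_pow_atTop_atTop_of_one_lt (one_lt_two (α := ℕ))))
  refine le_of_tendsto h1 (Eventually.of_forall fun k => ?_)
  have hsa : ∀ {x : A}, IsSelfAdjoint x → ∀ t : ℝ, IsSelfAdjoint (NormedSpace.exp (t • x)) :=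
    fun hx t => ((IsSelfAdjoint.all t).smul hx).exp
  have hpow : ∀ x : A, NormedSpace.exp (((2 ^ k : ℕ) : ℝ)⁻¹ • x) ^ 2 ^ k = NormedSpace.exp x := by
    intro x
    rw [← NormedSpace.exp_nsmul, ← Nat.cast_smul_eq_nsmul ℝ, smul_smul,
      mul_inv_cancel₀ (by positivity), one_smul]
  have h2 := (trace_pow_two_pow_le hcomm hstar hpos k).2 _ _
    (hsa ha ((2 ^ k : ℕ) : ℝ)⁻¹) (hsa hb ((2 ^ k : ℕ) : ℝ)⁻¹)
  rw [hpow, hpow] at h2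
  exact h2

/-! ### Traces and exponentials of self-adjoint operators -/

section Operator

variable {V : Type*} [NormedAddCommGroup V] [InnerProductSpace ℝ V]

/-- The trace of a continuous linear operator. -/
noncomputable def opTrace (V : Type*) [NormedAddCommGroup V] [InnerProductSpace ℝ V] :
    (V →L[ℝ] V) →ₗ[ℝ] ℝ :=
  LinearMap.trace ℝ V ∘ₗ ContinuousLinearMap.coeLM ℝ

theorem opTrace_eq_sum_inner {ι : Type*} [Fintype ι] (b : OrthonormalBasis ι ℝ V)
    (T : V →L[ℝ] V) : opTrace V T = ∑ i, inner ℝ (b i) (T (b i)) :=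
  LinearMap.trace_eq_sum_inner (T : V →ₗ[ℝ] V) b

theorem opTrace_mul_comm (S T : V →L[ℝ] V) : opTrace V (S * T) = opTrace V (T * S) :=
  LinearMap.trace_mul_comm ℝ (S : V →ₗ[ℝ] V) (T : V →ₗ[ℝ] V)

/-- In an eigenbasis, operator inequalities become scalar inequalities between eigenvalues. -/
theorem inner_apply_eq_sum_sq {ι : Type*} [Fintype ι] (b : OrthonormalBasis ι ℝ V)
    {T : V →L[ℝ] V} {t : ι → ℝ} (hT : ∀ i, T (b i) = t i • b i) (v : V) :
    inner ℝ v (T v) = ∑ i, t i * inner ℝ (b i) v ^ 2 := by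
  conv_lhs => rw [← b.sum_repr' v, map_sum, b.sum_repr' v]
  rw [inner_sum]
  refine Finset.sum_congr rfl fun i _ => ?_
  rw [map_smul, hT, inner_smul_right, inner_smul_right, real_inner_comm]
  ring

theorem abs_le_norm_of_apply_eq_smul {T : V →L[ℝ] V} {v : V} {μ : ℝ} (hv : ‖v‖ = 1)
    (h : T v = μ • v) : |μ| ≤ ‖T‖ := by
  have := T.le_opNorm v
  rwa [h, norm_smul, hv, mul_one, mul_one] at this

theorem norm_sq_eq_sum_inner_sq {ι : Type*} [Fintype ι] (b : OrthonormalBasis ι ℝ V) (v : V) :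
    ‖v‖ ^ 2 = ∑ i, inner ℝ (b i) v ^ 2 := by
  simpa using inner_apply_eq_sum_sq b (T := 1) (t := fun _ => 1) (fun i => by simp) v

variable [CompleteSpace V]

theorem exp_apply_of_apply_eq_smul {T : V →L[ℝ] V} {v : V} {μ : ℝ}
    (h : T v = μ • v) : NormedSpace.exp T v = Real.exp μ • v := by
  have hpow : ∀ n : ℕ, (T ^ n) v = μ ^ n • v := by
    intro n
    induction n with
    | zero => simp
    | succ n ih => rw [pow_succ', mul_apply_eq_comp, ih, map_smul, h, smul_smul,
        pow_succ]
  have h1 := (NormedSpace.exp_series_hasSum_exp' (𝕂 := ℝ) T).mapL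
    (ContinuousLinearMap.apply ℝ V v)
  have h2 := (NormedSpace.exp_series_hasSum_exp' (𝕂 := ℝ) μ).smul_const v
  rw [← Real.exp_eq_exp_ℝ] at h2
  simp only [ContinuousLinearMap.apply_apply, smul_apply, hpow] at h1
  simp only [smul_assoc] at h2
  exact h1.unique h2

theorem exp_half_mul_self (S : V →L[ℝ] V) :
    NormedSpace.exp ((2 : ℝ)⁻¹ • S) * NormedSpace.exp ((2 : ℝ)⁻¹ • S) = NormedSpace.exp S := by
  let _ : NormedAlgebra ℚ (V →L[ℝ] V) := NormedAlgebra.restrictScalars ℚ ℝ _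
  rw [← NormedSpace.exp_add_of_commute (Commute.refl _), ← two_smul ℝ, smul_smul]
  norm_num

theorem opTrace_exp_eq_sum {ι : Type*} [Fintype ι] (b : OrthonormalBasis ι ℝ V)
    {T : V →L[ℝ] V} {t : ι → ℝ} (hT : ∀ i, T (b i) = t i • b i) :
    opTrace V (NormedSpace.exp T) = ∑ i, Real.exp (t i) := by
  rw [opTrace_eq_sum_inner b]
  refine Finset.sum_congr rfl fun i _ => ?_
  rw [exp_apply_of_apply_eq_smul (hT i), inner_smul_right, real_inner_self_eq_norm_sq,
    b.norm_eq_one]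
  ring

theorem norm_apply_sq_eq_sum {ι : Type*} [Fintype ι] (b : OrthonormalBasis ι ℝ V)
    {T : V →L[ℝ] V} (hsa : IsSelfAdjoint T) {t : ι → ℝ} (hT : ∀ i, T (b i) = t i • b i) (v : V) :
    ‖T v‖ ^ 2 = ∑ i, t i ^ 2 * inner ℝ (b i) v ^ 2 := by
  have h := inner_apply_eq_sum_sq b (T := T * T) (t := fun i => t i ^ 2)
    (fun i => by rw [mul_apply_eq_comp, hT, map_smul, hT, smul_smul, pow_two]) v
  rw [← h, ← real_inner_self_eq_norm_sq]
  exact hsa.isSymmetric v (T v)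

variable [FiniteDimensional ℝ V]

theorem exists_eigenbasis {T : V →L[ℝ] V} (hT : IsSelfAdjoint T) :
    ∃ (b : OrthonormalBasis (Fin (Module.finrank ℝ V)) ℝ V)
      (t : Fin (Module.finrank ℝ V) → ℝ), ∀ i, T (b i) = t i • b i :=
  ⟨hT.isSymmetric.eigenvectorBasis rfl, hT.isSymmetric.eigenvalues rfl,
    fun i => hT.isSymmetric.apply_eigenvectorBasis rfl i⟩

theorem opTrace_star (T : V →L[ℝ] V) : opTrace V (star T) = opTrace V T := by
  rw [opTrace_eq_sum_inner (stdOrthonormalBasis ℝ V),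
    opTrace_eq_sum_inner (stdOrthonormalBasis ℝ V)]
  refine Finset.sum_congr rfl fun i _ => ?_
  rw [ContinuousLinearMap.star_eq_adjoint, ContinuousLinearMap.adjoint_inner_right,
    real_inner_comm]

theorem opTrace_mul_star_nonneg (T : V →L[ℝ] V) : 0 ≤ opTrace V (T * star T) := by
  rw [opTrace_mul_comm, opTrace_eq_sum_inner (stdOrthonormalBasis ℝ V)]
  refine Finset.sum_nonneg fun i _ => ?_
  rw [mul_apply_eq_comp, ContinuousLinearMap.star_eq_adjoint,
    ContinuousLinearMap.adjoint_inner_right]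
  exact real_inner_self_nonneg

theorem opTrace_exp_add_le [Nontrivial V] {S T : V →L[ℝ] V} (hS : IsSelfAdjoint S)
    (hT : IsSelfAdjoint T) :
    opTrace V (NormedSpace.exp (S + T)) ≤
      opTrace V (NormedSpace.exp S * NormedSpace.exp T) :=
  trace_exp_add_le (A := V →L[ℝ] V) (tr := opTrace V)
    (opTrace V).continuous_of_finiteDimensional opTrace_mul_comm opTrace_star
    opTrace_mul_star_nonneg hS hT

/-- With `exp S = R * R` and `R` self-adjoint, cyclicity gives `tr (R Q R)`, a sum of values of the
quadratic form of `Q` at the vectors `R bᵢ`. -/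
theorem opTrace_exp_mul_le {S Q : V →L[ℝ] V} (hS : IsSelfAdjoint S) {c : ℝ}
    (hQ : ∀ v, inner ℝ v (Q v) ≤ c * ‖v‖ ^ 2) :
    opTrace V (NormedSpace.exp S * Q) ≤ c * opTrace V (NormedSpace.exp S) := by
  let _ : NormedAlgebra ℚ (V →L[ℝ] V) := NormedAlgebra.restrictScalars ℚ ℝ _
  set R := NormedSpace.exp ((2 : ℝ)⁻¹ • S) with hR
  have hRsa : IsSelfAdjoint R := ((IsSelfAdjoint.all (2 : ℝ)⁻¹).smul hS).exp
  have hsym : ∀ u v, inner ℝ u (R v) = inner ℝ (R u) v := fun u v =>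
    (hRsa.isSymmetric u v).symm
  rw [← exp_half_mul_self S, ← hR, mul_assoc, opTrace_mul_comm,
    opTrace_eq_sum_inner (stdOrthonormalBasis ℝ V), opTrace_eq_sum_inner (stdOrthonormalBasis ℝ V),
    Finset.mul_sum]
  refine Finset.sum_le_sum fun i _ => ?_
  simp only [mul_apply_eq_comp]
  rw [hsym, hsym, real_inner_self_eq_norm_sq]
  exact hQ _

theorem opTrace_exp_nonneg {T : V →L[ℝ] V} (hT : IsSelfAdjoint T) :
    0 ≤ opTrace V (NormedSpace.exp T) := by
  obtain ⟨b, t, h⟩ := exists_eigenbasis hT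
  rw [opTrace_exp_eq_sum b h]
  positivity

/-- Some eigenvalue exceeds `r` in absolute value; its sign decides which of the two traces, both
sums of positive terms, is large. -/
theorem exp_le_opTrace_exp_add_opTrace_exp_neg {T : V →L[ℝ] V} (hT : IsSelfAdjoint T) {r : ℝ}
    (hr : 0 ≤ r) (h : r < ‖T‖) :
    Real.exp r ≤ opTrace V (NormedSpace.exp T) + opTrace V (NormedSpace.exp (-T)) := by
  obtain ⟨b, t, ht⟩ := exists_eigenbasis hT
  rw [opTrace_exp_eq_sum b ht, opTrace_exp_eq_sum b (T := -T) (t := fun i => -t i)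
    (fun i => by simp [ht])]
  obtain ⟨i, hi⟩ : ∃ i, r < |t i| := by
    by_contra! hcon
    refine h.not_ge (T.opNorm_le_bound hr fun v => ?_)
    refine le_of_sq_le_sq ?_ (by positivity)
    rw [norm_apply_sq_eq_sum b hT ht, mul_pow, norm_sq_eq_sum_inner_sq b v, Finset.mul_sum]
    refine Finset.sum_le_sum fun i _ => ?_
    gcongr ?_ * _
    exact sq_le_sq' (neg_le_of_abs_le (hcon i)) (le_of_abs_le (hcon i))
  have h1 : ∀ u : Fin (Module.finrank ℝ V) → ℝ, Real.exp (u i) ≤ ∑ j, Real.exp (u j) := fun u =>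
    Finset.single_le_sum (f := fun j => Real.exp (u j)) (fun j _ => (Real.exp_pos _).le)
      (Finset.mem_univ i)
  have h2 := h1 t
  have h3 := h1 fun j => -t j
  have h4 : ∀ u : Fin (Module.finrank ℝ V) → ℝ, 0 ≤ ∑ j, Real.exp (u j) := fun u => by positivity
  rcases lt_abs.1 hi with h5 | h5
  · linarith [Real.exp_le_exp.2 h5.le, h4 fun j => -t j]
  · linarith [Real.exp_le_exp.2 h5.le, h4 t]

/-- The range `r ≤ 2` fits `‖θ • (X i - M)‖ ≤ 2|θ|W ≤ 2`. At `r = 2|θ|W`, the `1/8` makes `1 + r²/8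
= 1 + u/2` with `u = θ²W²`, so the moment bound becomes `1 + u + u²/2 ≤ exp u`. -/
theorem Real.exp_le_one_add_add_sq_add {r : ℝ} (hr : r ≤ 2) :
    Real.exp r ≤ 1 + r + r ^ 2 + r ^ 4 / 8 := by
  rcases le_total r (-1) with h | h
  · have := Real.exp_le_one_iff.2 (by linarith : r ≤ 0)
    nlinarith [sq_nonneg (r ^ 2)]
  rcases le_total r 1 with h' | h'
  · have h1 := (abs_le.1 (Real.abs_exp_sub_one_sub_id_le (abs_le.2 ⟨h, h'⟩))).2
    nlinarith [sq_nonneg (r ^ 2)]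
  · obtain ⟨u, rfl⟩ : ∃ u, r = 1 + u := ⟨r - 1, by ring⟩
    have hu0 : 0 ≤ u := by linarith
    have hu1 : u ≤ 1 := by linarith
    have h1 := (abs_le.1 (Real.abs_exp_sub_one_sub_id_le (abs_le.2 ⟨by linarith, hu1⟩))).2
    have h2 := Real.exp_one_lt_d9
    rw [Real.exp_add]
    have h3 : Real.exp 1 * Real.exp u ≤ 2.7182818286 * (1 + u + u ^ 2) :=
      mul_le_mul h2.le (by linarith) (Real.exp_pos _).le (by norm_num)
    refine h3.trans ?_
    nlinarith [sq_nonneg (u - 1 / 2), mul_nonneg hu0 (sq_nonneg (u - 1)),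
      mul_nonneg hu0 (sub_nonneg.2 hu1), pow_nonneg hu0 3, pow_nonneg hu0 4]

theorem inner_exp_apply_le {T : V →L[ℝ] V} (hT : IsSelfAdjoint T) {r : ℝ} (hTr : ‖T‖ ≤ r)
    (hr : r ≤ 2) (v : V) :
    inner ℝ v (NormedSpace.exp T v) ≤
      ‖v‖ ^ 2 + inner ℝ v (T v) + (1 + r ^ 2 / 8) * ‖T v‖ ^ 2 := by
  obtain ⟨b, t, ht⟩ := exists_eigenbasis hT
  rw [inner_apply_eq_sum_sq b (fun i => exp_apply_of_apply_eq_smul (ht i)),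
    inner_apply_eq_sum_sq b ht, norm_apply_sq_eq_sum b hT ht, norm_sq_eq_sum_inner_sq b v,
    Finset.mul_sum, ← Finset.sum_add_distrib, ← Finset.sum_add_distrib]
  refine Finset.sum_le_sum fun i _ => ?_
  have h1 : |t i| ≤ r := (abs_le_norm_of_apply_eq_smul (b.norm_eq_one i) (ht i)).trans hTr
  have h2 := Real.exp_le_one_add_add_sq_add ((le_of_abs_le h1).trans hr)
  have h3 : t i ^ 2 ≤ r ^ 2 := sq_le_sq' (neg_le_of_abs_le h1) (le_of_abs_le h1)
  have h4 : Real.exp (t i) ≤ 1 + t i + (1 + r ^ 2 / 8) * t i ^ 2 := by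
    nlinarith [mul_le_mul_of_nonneg_left h3 (sq_nonneg (t i))]
  calc Real.exp (t i) * inner ℝ (b i) v ^ 2
      ≤ (1 + t i + (1 + r ^ 2 / 8) * t i ^ 2) * inner ℝ (b i) v ^ 2 := by gcongr
    _ = _ := by ring

/-- The trace of the expected exponential of a sum of independent self-adjoint operators. -/
theorem sum_prod_mul_opTrace_exp_le [Nontrivial V] {ι : Type*} [Fintype ι] {p : ι → ℝ}
    (hp : ∀ i, 0 ≤ p i) {Y : ι → V →L[ℝ] V} (hY : ∀ i, IsSelfAdjoint (Y i)) {c : ℝ} (hc : 0 ≤ c)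
    (hYc : ∀ v, ∑ i, p i * inner ℝ v (NormedSpace.exp (Y i) v) ≤ c * ‖v‖ ^ 2) (s : ℕ) :
    ∑ k : Fin s → ι, (∏ j, p (k j)) * opTrace V (NormedSpace.exp (∑ j, Y (k j))) ≤
      Module.finrank ℝ V * c ^ s := by
  induction s with
  | zero =>
    simp [opTrace_eq_sum_inner (stdOrthonormalBasis ℝ V)]
  | succ s ih =>
    -- Fix all draws but the first: Golden–Thompson detaches its exponential, and averaging inside
    -- the trace costs one factor `c`.
    rw [← (Fin.consEquiv fun _ => ι).sum_comp, Fintype.sum_prod_type_right, pow_succ',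
      mul_left_comm]
    refine le_trans ?_ (mul_le_mul_of_nonneg_left ih hc)
    rw [Finset.mul_sum]
    refine Finset.sum_le_sum fun k _ => ?_
    simp only [Fin.consEquiv_apply, Fin.prod_univ_succ, Fin.sum_univ_succ, Fin.cons_zero,
      Fin.cons_succ]
    set S := ∑ j, Y (k j) with hS
    have hSsa : IsSelfAdjoint S := isSelfAdjoint_sum _ fun j _ => hY _
    have hP : 0 ≤ ∏ j, p (k j) := Finset.prod_nonneg fun j _ => hp _
    have h1 := opTrace_exp_mul_le hSsa (Q := ∑ i, p i • NormedSpace.exp (Y i)) (c := c)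
      (fun v => by
        simpa [sum_apply, inner_sum, inner_smul_right] using hYc v)
    rw [mul_left_comm]
    refine le_trans ?_ (mul_le_mul_of_nonneg_left h1 hP)
    rw [Finset.mul_sum, map_sum, Finset.mul_sum]
    refine Finset.sum_le_sum fun i _ => ?_
    rw [mul_smul_comm, map_smul, smul_eq_mul, mul_comm (p i), mul_assoc]
    gcongr
    · exact hp i
    rw [add_comm]
    exact opTrace_exp_add_le hSsa (hY i)

end Operator

/-! ### The operator Chernoff bound -/

section Chernoff

variable {V : Type*} [NormedAddCommGroup V] [InnerProductSpace ℝ V]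
  {ι : Type*} [Fintype ι] {p : ι → ℝ} {X : ι → V →L[ℝ] V} {W : ℝ}

theorem norm_sum_smul_le_of_sum_eq_one (hp : ∀ i, 0 ≤ p i) (hp1 : ∑ i, p i = 1)
    (hXW : ∀ i, ‖X i‖ ≤ W) : ‖∑ i, p i • X i‖ ≤ W :=
  calc ‖∑ i, p i • X i‖ ≤ ∑ i, p i * W := norm_sum_le_of_le _ fun i _ => by
        rw [norm_smul, Real.norm_of_nonneg (hp i)]
        exact mul_le_mul_of_nonneg_left (hXW i) (hp i)
    _ = W := by rw [← Finset.sum_mul, hp1, one_mul]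

/-- Centring does not increase the second moment, so the variance is controlled by `W²` and not by
`(2W)²`. -/
theorem sum_mul_norm_sub_sq_le (hp1 : ∑ i, p i = 1) (x : ι → V) :
    ∑ i, p i * ‖x i - ∑ j, p j • x j‖ ^ 2 ≤ ∑ i, p i * ‖x i‖ ^ 2 := by
  set m := ∑ j, p j • x j with hm
  have h1 : ∑ i, p i * inner ℝ (x i) m = ‖m‖ ^ 2 := by
    rw [← real_inner_self_eq_norm_sq]
    conv_rhs => enter [2]; rw [hm]
    simp [sum_inner, real_inner_smul_left]
  have h2 : ∑ i, p i * ‖x i - m‖ ^ 2 = ∑ i, p i * ‖x i‖ ^ 2 - ‖m‖ ^ 2 := by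
    simp_rw [norm_sub_sq_real, mul_add, mul_sub, Finset.sum_add_distrib, Finset.sum_sub_distrib,
      ← Finset.sum_mul, hp1, mul_left_comm _ (2 : ℝ), ← Finset.mul_sum, h1]
    ring
  rw [h2]
  linarith [sq_nonneg ‖m‖]

variable [FiniteDimensional ℝ V] [CompleteSpace V]

/-- The operator moment generating function of a bounded self-adjoint random operator. -/
theorem sum_mul_inner_exp_le (hp : ∀ i, 0 ≤ p i) (hp1 : ∑ i, p i = 1)
    (hX : ∀ i, IsSelfAdjoint (X i)) (hXW : ∀ i, ‖X i‖ ≤ W) {θ : ℝ} (hθ : |θ| * W ≤ 1) (v : V) :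
    ∑ i, p i * inner ℝ v (NormedSpace.exp (θ • (X i - ∑ j, p j • X j)) v) ≤
      Real.exp (θ ^ 2 * W ^ 2) * ‖v‖ ^ 2 := by
  set M := ∑ j, p j • X j with hM
  have hMsa : IsSelfAdjoint M := isSelfAdjoint_sum _ fun j _ => (IsSelfAdjoint.all _).smul (hX j)
  have hMv : ∑ j, p j • X j v = M v := by simp [hM, sum_apply]
  have hMW : ‖M‖ ≤ W := norm_sum_smul_le_of_sum_eq_one hp hp1 hXW
  have hpt : ∀ i, p i * inner ℝ v (NormedSpace.exp (θ • (X i - M)) v) ≤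
      p i * ‖v‖ ^ 2 + θ * inner ℝ v (p i • X i v - p i • M v)
        + (1 + θ ^ 2 * W ^ 2 / 2) * θ ^ 2 * (p i * ‖X i v - M v‖ ^ 2) := by
    intro i
    have hnorm : ‖θ • (X i - M)‖ ≤ 2 * (|θ| * W) := by
      rw [norm_smul, Real.norm_eq_abs]
      have := (norm_sub_le (X i) M).trans (add_le_add (hXW i) hMW)
      nlinarith [abs_nonneg θ]
    have h := inner_exp_apply_le ((IsSelfAdjoint.all θ).smul ((hX i).sub hMsa)) hnorm
      (by linarith) v
    refine (mul_le_mul_of_nonneg_left h (hp i)).trans (le_of_eq ?_)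
    rw [smul_apply, sub_apply, inner_smul_right, norm_smul, Real.norm_eq_abs, mul_pow, mul_pow,
      mul_pow, sq_abs, ← smul_sub, inner_smul_right]
    ring
  have hvar : ∑ i, p i * ‖X i v - M v‖ ^ 2 ≤ W ^ 2 * ‖v‖ ^ 2 := by
    have h1 := sum_mul_norm_sub_sq_le hp1 fun i => X i v
    rw [hMv] at h1
    refine h1.trans ?_
    calc ∑ i, p i * ‖X i v‖ ^ 2 ≤ ∑ i, p i * (W * ‖v‖) ^ 2 := by
          refine Finset.sum_le_sum fun i _ => mul_le_mul_of_nonneg_left ?_ (hp i)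
          gcongr
          exact (X i).le_of_opNorm_le (hXW i) v
      _ = W ^ 2 * ‖v‖ ^ 2 := by rw [← Finset.sum_mul, hp1, one_mul, mul_pow]
  have hzero : ∑ i, inner ℝ v (p i • X i v - p i • M v) = 0 := by
    rw [← inner_sum, Finset.sum_sub_distrib, hMv, ← Finset.sum_smul, hp1, one_smul, sub_self,
      inner_zero_right]
  calc ∑ i, p i * inner ℝ v (NormedSpace.exp (θ • (X i - M)) v)
      ≤ ∑ i, (p i * ‖v‖ ^ 2 + θ * inner ℝ v (p i • X i v - p i • M v)
        + (1 + θ ^ 2 * W ^ 2 / 2) * θ ^ 2 * (p i * ‖X i v - M v‖ ^ 2)) :=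
        Finset.sum_le_sum fun i _ => hpt i
    _ = ‖v‖ ^ 2 + (1 + θ ^ 2 * W ^ 2 / 2) * θ ^ 2 * ∑ i, p i * ‖X i v - M v‖ ^ 2 := by
        rw [Finset.sum_add_distrib, Finset.sum_add_distrib, ← Finset.sum_mul, hp1,
          ← Finset.mul_sum, hzero, ← Finset.mul_sum]
        ring
    _ ≤ ‖v‖ ^ 2 + (1 + θ ^ 2 * W ^ 2 / 2) * θ ^ 2 * (W ^ 2 * ‖v‖ ^ 2) := by gcongr
    _ = (1 + θ ^ 2 * W ^ 2 + (θ ^ 2 * W ^ 2) ^ 2 / 2) * ‖v‖ ^ 2 := by ring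
    _ ≤ _ := by
        gcongr
        exact Real.quadratic_le_exp_of_nonneg (by positivity)

/-- A Chernoff bound for the mean of `s` independent draws of a bounded self-adjoint operator. -/
theorem sum_prod_filter_lt_norm_le [Nontrivial V] (hp : ∀ i, 0 ≤ p i) (hp1 : ∑ i, p i = 1)
    (hX : ∀ i, IsSelfAdjoint (X i)) (hXW : ∀ i, ‖X i‖ ≤ W) {τ : ℝ} (hτ : 0 < τ) {s : ℕ}
    (hs : 0 < s) :
    ∑ k : Fin s → ι with τ < ‖(s : ℝ)⁻¹ • ∑ j, X (k j) - ∑ i, p i • X i‖, ∏ j, p (k j) ≤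
      2 * Module.finrank ℝ V * Real.exp (-(s * τ ^ 2 / (4 * W ^ 2))) := by
  have hs' : (0 : ℝ) < s := by exact_mod_cast hs
  set M := ∑ i, p i • X i with hM
  have hMW : ‖M‖ ≤ W := norm_sum_smul_le_of_sum_eq_one hp hp1 hXW
  have hMsa : IsSelfAdjoint M := isSelfAdjoint_sum _ fun j _ => (IsSelfAdjoint.all _).smul (hX j)
  -- Both means have norm at most `W`, so a deviation above `2W` is impossible. Otherwise `θW =
  -- τ/(2W) < 1`, as the moment bound requires.
  rcases le_or_gt (2 * W) τ with h2W | h2W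
  · rw [Finset.filter_eq_empty_iff.2, Finset.sum_empty]
    · positivity
    · intro k _
      rw [not_lt]
      have h1 : ‖∑ j, X (k j)‖ ≤ s * W := by
        refine (norm_sum_le_of_le _ fun j _ => hXW (k j)).trans (le_of_eq ?_)
        simp
      have h2 : ‖(s : ℝ)⁻¹ • ∑ j, X (k j)‖ ≤ W := by
        rw [norm_smul, norm_inv, Real.norm_natCast, inv_mul_le_iff₀ hs']
        exact h1
      linarith [norm_sub_le ((s : ℝ)⁻¹ • ∑ j, X (k j)) M]
  have hW : 0 < W := by linarith
  -- The minimiser of `sθ²W² - θsτ`.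
  set θ := τ / (2 * W ^ 2) with hθ
  have hθ0 : 0 < θ := by positivity
  have hθW : |θ| * W ≤ 1 := by
    rw [abs_of_pos hθ0, hθ, div_mul_eq_mul_div, div_le_one (by positivity)]
    nlinarith
  have key : ∀ η : ℝ, |η| = θ →
      ∑ k : Fin s → ι, (∏ j, p (k j)) * opTrace V (NormedSpace.exp (∑ j, η • (X (k j) - M))) ≤
        Module.finrank ℝ V * Real.exp (θ ^ 2 * W ^ 2) ^ s := by
    intro η hη
    refine sum_prod_mul_opTrace_exp_le hp (Y := fun i => η • (X i - M))
      (fun i => (IsSelfAdjoint.all η).smul ((hX i).sub hMsa)) (Real.exp_pos _).le (fun v => ?_) s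
    have h := sum_mul_inner_exp_le hp hp1 hX hXW (θ := η)
      (by rwa [hη, ← abs_of_pos hθ0]) v
    rwa [← sq_abs η, hη] at h
  have hmark : ∀ k : Fin s → ι, τ < ‖(s : ℝ)⁻¹ • ∑ j, X (k j) - M‖ →
      Real.exp (θ * s * τ) ≤ opTrace V (NormedSpace.exp (∑ j, θ • (X (k j) - M)))
        + opTrace V (NormedSpace.exp (∑ j, (-θ) • (X (k j) - M))) := by
    intro k hk
    have h1 : ∑ j, θ • (X (k j) - M) = (θ * s) • ((s : ℝ)⁻¹ • ∑ j, X (k j) - M) := by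
      rw [← Finset.smul_sum, Finset.sum_sub_distrib, Finset.sum_const, Finset.card_univ,
        Fintype.card_fin, mul_smul, smul_sub (s : ℝ), smul_smul (s : ℝ), mul_inv_cancel₀ hs'.ne',
        one_smul, Nat.cast_smul_eq_nsmul]
    have h2 : ∑ j, (-θ) • (X (k j) - M) = -∑ j, θ • (X (k j) - M) := by
      simp [neg_smul]
    rw [h2]
    refine exp_le_opTrace_exp_add_opTrace_exp_neg
      (isSelfAdjoint_sum _ fun j _ => (IsSelfAdjoint.all θ).smul ((hX _).sub hMsa))
      (by positivity) ?_
    rw [h1, norm_smul, Real.norm_of_nonneg (by positivity)]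
    gcongr
  have hsum : (∑ k : Fin s → ι with τ < ‖(s : ℝ)⁻¹ • ∑ j, X (k j) - M‖, ∏ j, p (k j))
      * Real.exp (θ * s * τ) ≤ 2 * Module.finrank ℝ V * Real.exp (θ ^ 2 * W ^ 2) ^ s := by
    have hP : ∀ k : Fin s → ι, 0 ≤ ∏ j, p (k j) := fun k => Finset.prod_nonneg fun j _ => hp _
    have htr : ∀ (η : ℝ) (k : Fin s → ι),
        0 ≤ opTrace V (NormedSpace.exp (∑ j, η • (X (k j) - M))) := fun η k =>
      opTrace_exp_nonneg
        (isSelfAdjoint_sum _ fun j _ => (IsSelfAdjoint.all η).smul ((hX _).sub hMsa))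
    rw [Finset.sum_mul]
    calc _ ≤ ∑ k : Fin s → ι with τ < ‖(s : ℝ)⁻¹ • ∑ j, X (k j) - M‖, (∏ j, p (k j)) *
          (opTrace V (NormedSpace.exp (∑ j, θ • (X (k j) - M)))
            + opTrace V (NormedSpace.exp (∑ j, (-θ) • (X (k j) - M)))) :=
          Finset.sum_le_sum fun k hk =>
            mul_le_mul_of_nonneg_left (hmark k (Finset.mem_filter.1 hk).2) (hP k)
      _ ≤ ∑ k : Fin s → ι, (∏ j, p (k j)) *
          (opTrace V (NormedSpace.exp (∑ j, θ • (X (k j) - M)))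
            + opTrace V (NormedSpace.exp (∑ j, (-θ) • (X (k j) - M)))) :=
          Finset.sum_le_sum_of_subset_of_nonneg (Finset.filter_subset _ _) fun k _ _ =>
            mul_nonneg (hP k) (add_nonneg (htr _ k) (htr _ k))
      _ ≤ _ := by
          simp_rw [mul_add, Finset.sum_add_distrib]
          linarith [key θ (abs_of_pos hθ0), key (-θ) (by rw [abs_neg, abs_of_pos hθ0])]
  rw [← le_div_iff₀ (Real.exp_pos _), ← Real.exp_nat_mul, mul_div_assoc, ← Real.exp_sub] at hsum
  refine hsum.trans (le_of_eq ?_)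
  congr 2
  rw [hθ]
  field_simp
  ring

end Chernoff

/-! ### Hessians as derivatives of gradients -/

section Hessian

variable {E F : Type*} [NormedAddCommGroup E] [InnerProductSpace ℝ E]
  [NormedAddCommGroup F] [InnerProductSpace ℝ F]

theorem fderiv_fderiv_comp_apply {g : F → ℝ} (hg : ContDiff ℝ 2 g) (L : E →L[ℝ] F) (w u v : E) :
    fderiv ℝ (fderiv ℝ fun z => g (L z)) w u v = fderiv ℝ (fderiv ℝ g) (L w) (L u) (L v) := by
  have hd : DifferentiableAt ℝ (fderiv ℝ g) (L w) :=
    (hg.fderiv_right (m := 1) (by norm_num)).differentiable one_ne_zero _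
  have h1 : (fderiv ℝ fun z => g (L z)) =
      fun z => ContinuousLinearMap.precomp ℝ L (fderiv ℝ g (L z)) := by
    funext z
    exact ((hg.differentiable two_ne_zero (L z)).hasFDerivAt.comp z L.hasFDerivAt).fderiv
  have h2 := (ContinuousLinearMap.precomp ℝ L).hasFDerivAt.comp w
    (hd.hasFDerivAt.comp w L.hasFDerivAt)
  rw [h1]
  erw [h2.fderiv]
  rfl

variable [CompleteSpace E] [CompleteSpace F]

/-- The gradient is the Riesz image of the derivative; this passes to the bilinear second
derivative, where symmetry and the chain rule apply. -/
theorem inner_fderiv_gradient {g : E → ℝ} (hg : ContDiff ℝ 2 g) (w u v : E) :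
    inner ℝ (fderiv ℝ (gradient g) w u) v = fderiv ℝ (fderiv ℝ g) w u v := by
  have hd : DifferentiableAt ℝ (fderiv ℝ g) w :=
    (hg.fderiv_right (m := 1) (by norm_num)).differentiable one_ne_zero w
  let D : StrongDual ℝ E ≃L[ℝ] E := (InnerProductSpace.toDual ℝ E).symm.toContinuousLinearEquiv
  have h1 : HasFDerivAt (gradient g) ((D : StrongDual ℝ E →L[ℝ] E) ∘L fderiv ℝ (fderiv ℝ g) w) w :=
    (D : StrongDual ℝ E →L[ℝ] E).hasFDerivAt.comp w hd.hasFDerivAt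
  rw [h1.fderiv]
  exact InnerProductSpace.toDual_symm_apply

theorem isSelfAdjoint_fderiv_gradient {g : E → ℝ} (hg : ContDiff ℝ 2 g) (w : E) :
    IsSelfAdjoint (fderiv ℝ (gradient g) w) := by
  rw [ContinuousLinearMap.isSelfAdjoint_iff_isSymmetric]
  intro u v
  have hs : IsSymmSndFDerivAt ℝ g w := hg.contDiffAt.isSymmSndFDerivAt (by simp)
  have h1 := inner_fderiv_gradient hg w u v
  have h2 := inner_fderiv_gradient hg w v u
  rw [ContinuousLinearMap.coe_coe, h1, hs.eq, ← h2, real_inner_comm]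

/-- The Hessian of `g ∘ L` is `L⋆ S L`; testing `T u` against itself avoids writing the adjoint. -/
theorem norm_fderiv_gradient_comp_le {g : F → ℝ} (hg : ContDiff ℝ 2 g) (L : E →L[ℝ] F) (w : E) :
    ‖fderiv ℝ (gradient fun z => g (L z)) w‖ ≤ ‖fderiv ℝ (gradient g) (L w)‖ * ‖L‖ ^ 2 := by
  have hgL : ContDiff ℝ 2 fun z => g (L z) := hg.comp L.contDiff
  set T := fderiv ℝ (gradient fun z => g (L z)) w with hT
  set S := fderiv ℝ (gradient g) (L w) with hS
  refine T.opNorm_le_bound (by positivity) fun u => ?_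
  have h1 : ‖T u‖ * ‖T u‖ ≤ ‖S‖ * ‖L‖ ^ 2 * ‖u‖ * ‖T u‖ :=
    calc ‖T u‖ * ‖T u‖ = inner ℝ (T u) (T u) := (real_inner_self_eq_norm_mul_norm _).symm
      _ = inner ℝ (S (L u)) (L (T u)) := by
          rw [hT, inner_fderiv_gradient hgL, fderiv_fderiv_comp_apply hg,
            ← inner_fderiv_gradient hg]
      _ ≤ ‖S (L u)‖ * ‖L (T u)‖ := real_inner_le_norm _ _
      _ ≤ (‖S‖ * (‖L‖ * ‖u‖)) * (‖L‖ * ‖T u‖) := by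
          gcongr
          · exact S.le_opNorm_of_le (L.le_opNorm u)
          · exact L.le_opNorm _
      _ = _ := by ring
  rcases (norm_nonneg (T u)).eq_or_lt with h | h
  · rw [← h]; positivity
  · exact le_of_mul_le_mul_right h1 h

theorem fderiv_gradient_const_mul_sum {ι : Type*} [Fintype ι] {g : ι → E → ℝ}
    (hg : ∀ i, ContDiff ℝ 2 (g i)) (c : ℝ) (w : E) :
    fderiv ℝ (gradient fun z => c * ∑ i, g i z) w = c • ∑ i, fderiv ℝ (gradient (g i)) w := by
  have hG : ContDiff ℝ 2 fun z => c * ∑ i, g i z :=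
    contDiff_const.mul (ContDiff.sum fun i _ => hg i)
  have h1 : (fderiv ℝ fun z => c * ∑ i, g i z) = fun z => c • ∑ i, fderiv ℝ (g i) z := by
    funext z
    exact ((HasFDerivAt.fun_sum fun i _ =>
      ((hg i).differentiable two_ne_zero z).hasFDerivAt).const_mul c).fderiv
  have h2 := (HasFDerivAt.fun_sum (u := Finset.univ) fun i _ =>
      (((hg i).fderiv_right (m := 1) (by norm_num)).differentiable one_ne_zero
        w).hasFDerivAt).const_smul c
  ext u
  refine ext_inner_right ℝ fun v => ?_
  rw [inner_fderiv_gradient hG, h1]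
  erw [h2.fderiv]
  simp [sum_apply, sum_inner, real_inner_smul_left, inner_fderiv_gradient (hg _)]

end Hessian

/-! ### Norm bounds for the summand Hessians -/

section Ridge

variable {m n : ℕ}

/-- The linear map `(x, y) ↦ (aᵀx, bᵀy)`. -/
noncomputable def ridgeMap (a : EuclideanSpace ℝ (Fin m)) (b : EuclideanSpace ℝ (Fin n)) :
    WithLp 2 (EuclideanSpace ℝ (Fin m) × EuclideanSpace ℝ (Fin n)) →L[ℝ] WithLp 2 (ℝ × ℝ) :=
  (WithLp.prodContinuousLinearEquiv 2 ℝ ℝ ℝ).symm.toContinuousLinearMap ∘L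
    ((innerSL ℝ a ∘L WithLp.fstL 2 ℝ _ _).prod (innerSL ℝ b ∘L WithLp.sndL 2 ℝ _ _))

theorem norm_ridgeMap_sq_le (a : EuclideanSpace ℝ (Fin m)) (b : EuclideanSpace ℝ (Fin n)) :
    ‖ridgeMap a b‖ ^ 2 ≤ ‖a‖ ^ 2 + ‖b‖ ^ 2 := by
  rw [← Real.sq_sqrt (by positivity : 0 ≤ ‖a‖ ^ 2 + ‖b‖ ^ 2)]
  gcongr
  refine ContinuousLinearMap.opNorm_le_bound _ (Real.sqrt_nonneg _) fun z => ?_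
  refine le_of_sq_le_sq ?_ (by positivity)
  rw [mul_pow, Real.sq_sqrt (by positivity), WithLp.prod_norm_sq_eq_of_L2,
    WithLp.prod_norm_sq_eq_of_L2 z]
  have h1 : (inner ℝ a z.fst) ^ 2 ≤ ‖a‖ ^ 2 * ‖z.fst‖ ^ 2 := by
    rw [← mul_pow, ← sq_abs (inner ℝ a z.fst)]
    gcongr
    exact abs_real_inner_le_norm _ _
  have h2 : (inner ℝ b z.snd) ^ 2 ≤ ‖b‖ ^ 2 * ‖z.snd‖ ^ 2 := by
    rw [← mul_pow, ← sq_abs (inner ℝ b z.snd)]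
    gcongr
    exact abs_real_inner_le_norm _ _
  have h3 : ‖(ridgeMap a b z).fst‖ ^ 2 = (inner ℝ a z.fst) ^ 2 := by
    rw [Real.norm_eq_abs, sq_abs]; rfl
  have h4 : ‖(ridgeMap a b z).snd‖ ^ 2 = (inner ℝ b z.snd) ^ 2 := by
    rw [Real.norm_eq_abs, sq_abs]; rfl
  rw [h3, h4]
  nlinarith [mul_nonneg (sq_nonneg ‖a‖) (sq_nonneg ‖z.snd‖),
    mul_nonneg (sq_nonneg ‖b‖) (sq_nonneg ‖z.fst‖)]

variable {φ : ℝ → ℝ → ℝ}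
  (a : EuclideanSpace ℝ (Fin m)) (b : EuclideanSpace ℝ (Fin n))
  (x : EuclideanSpace ℝ (Fin m)) (y : EuclideanSpace ℝ (Fin n))

theorem contDiff_withLp (hφ : ContDiff ℝ 2 fun q : ℝ × ℝ => φ q.1 q.2) :
    ContDiff ℝ 2 fun z : WithLp 2 (ℝ × ℝ) => φ z.fst z.snd :=
  hφ.comp (WithLp.prodContinuousLinearEquiv 2 ℝ ℝ ℝ).contDiff

theorem contDiff_ridge (hφ : ContDiff ℝ 2 fun q : ℝ × ℝ => φ q.1 q.2) :
    ContDiff ℝ 2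
    fun z : WithLp 2 (EuclideanSpace ℝ (Fin m) × EuclideanSpace ℝ (Fin n)) =>
      ridge φ a b z.fst z.snd :=
  (contDiff_withLp hφ).comp (ridgeMap a b).contDiff

theorem isSelfAdjoint_fullHessian_ridge (hφ : ContDiff ℝ 2 fun q : ℝ × ℝ => φ q.1 q.2) :
    IsSelfAdjoint (fullHessian (ridge φ a b) x y) :=
  isSelfAdjoint_fderiv_gradient (contDiff_ridge a b hφ) _

theorem norm_fullHessian_ridge_le (hφ : ContDiff ℝ 2 fun q : ℝ × ℝ => φ q.1 q.2) :
    ‖fullHessian (ridge φ a b) x y‖ ≤ hessWeight φ a b x y :=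
  (norm_fderiv_gradient_comp_le (contDiff_withLp hφ) (ridgeMap a b) (WithLp.toLp 2 (x, y))).trans
    (mul_le_mul_of_nonneg_left (norm_ridgeMap_sq_le a b) (norm_nonneg _))

end Ridge

/-! ### Importance sampling and the final probability estimate -/

theorem fullHessian_finiteSum {N m n : ℕ} {f : Fin N → ℝ → ℝ → ℝ}
    (hf : ∀ i, ContDiff ℝ 2 (fun q : ℝ × ℝ => f i q.1 q.2))
    (a : Fin N → EuclideanSpace ℝ (Fin m)) (b : Fin N → EuclideanSpace ℝ (Fin n))
    (x : EuclideanSpace ℝ (Fin m)) (y : EuclideanSpace ℝ (Fin n)) :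
    fullHessian (finiteSum f a b) x y =
      (1 / (N : ℝ)) • ∑ i, fullHessian (ridge (f i) (a i) (b i)) x y :=
  fderiv_gradient_const_mul_sum (fun i => contDiff_ridge (a i) (b i) (hf i)) _ _

/-- The law of finitely many independent discrete variables is bounded by the product law. -/
theorem measureReal_setOf_le_sum_prod {s : ℕ} {ι Ω : Type*} [Fintype ι] [MeasurableSpace ι]
    [MeasurableSingletonClass ι] [MeasurableSpace Ω] {P : Measure Ω} {ξ : Fin s → Ω → ι}
    (hind : iIndepFun ξ P) {p : ι → ℝ} (hlaw : ∀ j i, P.real {ω | ξ j ω = i} = p i)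
    (q : (Fin s → ι) → Prop) [DecidablePred q] :
    P.real {ω | q fun j => ξ j ω} ≤ ∑ k : Fin s → ι with q k, ∏ j, p (k j) := by
  have := hind.isProbabilityMeasure
  have h1 : ∀ k : Fin s → ι, P.real {ω | ∀ j, ξ j ω = k j} = ∏ j, p (k j) := by
    intro k
    have h := iIndepFun_iff_measure_inter_preimage_eq_mul.1 hind Finset.univ
      (sets := fun j => {k j}) fun j _ => measurableSet_singleton _
    have h2 : {ω | ∀ j, ξ j ω = k j} = ⋂ j ∈ Finset.univ, ξ j ⁻¹' {k j} := by
      ext ω; simp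
    rw [Measure.real, h2, h, ENNReal.toReal_prod]
    exact Finset.prod_congr rfl fun j _ => hlaw j (k j)
  -- Covering by the events of a fixed outcome needs only subadditivity, so no measurability of the
  -- bad event.
  have h2 : {ω | q fun j => ξ j ω} ⊆
      ⋃ k ∈ (Finset.univ.filter q : Finset (Fin s → ι)), {ω | ∀ j, ξ j ω = k j} := by
    intro ω hω
    simp only [Set.mem_iUnion]
    exact ⟨fun j => ξ j ω, Finset.mem_filter.2 ⟨Finset.mem_univ _, hω⟩, fun _ => rfl⟩
  calc P.real {ω | q fun j => ξ j ω}
      ≤ P.real (⋃ k ∈ (Finset.univ.filter q : Finset (Fin s → ι)), {ω | ∀ j, ξ j ω = k j}) :=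
        measureReal_mono h2 (measure_ne_top _ _)
    _ ≤ ∑ k : Fin s → ι with q k, P.real {ω | ∀ j, ξ j ω = k j} :=
        measureReal_biUnion_finset_le _ _
    _ = _ := Finset.sum_congr rfl fun k _ => h1 k

theorem one_sub_le_measureReal_setOf_le {Ω : Type*} [MeasurableSpace Ω] {P : Measure Ω}
    [IsProbabilityMeasure P] {g : Ω → ℝ} {τ δ : ℝ} (h : P.real {ω | τ < g ω} ≤ δ) :
    1 - δ ≤ P.real {ω | g ω ≤ τ} := by
  refine (sub_le_sub_left h 1).trans (sub_le_iff_le_add.2 ?_)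
  refine le_trans (le_of_eq ?_) (measureReal_union_le _ _)
  rw [← probReal_univ (μ := P)]
  congr 1
  ext ω
  simpa using le_or_gt (g ω) τ

/-- The Chernoff exponent involves the actual average weight `W`, the sample size its bound `B`.
Positivity of the logarithm forces `s > 0`. -/
theorem two_mul_exp_neg_le {d B W τ δ s : ℝ} (hd : 1 ≤ d) (hW : 0 < W) (hWB : W ≤ B)
    (hτ : 0 < τ) (hδ0 : 0 < δ) (hδ1 : δ < 1)
    (hs : 4 * B ^ 2 / τ ^ 2 * Real.log (2 * d / δ) ≤ s) :
    0 < s ∧ 2 * d * Real.exp (-(s * τ ^ 2 / (4 * W ^ 2))) ≤ δ := by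
  have hB : 0 < B := hW.trans_le hWB
  have hlog : 0 < Real.log (2 * d / δ) := Real.log_pos (by rw [one_lt_div hδ0]; linarith)
  refine ⟨lt_of_lt_of_le (by positivity) hs, ?_⟩
  have h1 : Real.log (2 * d / δ) ≤ s * τ ^ 2 / (4 * W ^ 2) := by
    rw [le_div_iff₀ (by positivity)]
    rw [div_mul_eq_mul_div, div_le_iff₀ (by positivity)] at hs
    have : W ^ 2 ≤ B ^ 2 := by gcongr
    nlinarith
  have h2 : 2 * d / δ ≤ Real.exp (s * τ ^ 2 / (4 * W ^ 2)) :=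
    (Real.log_le_iff_le_exp (by positivity)).1 h1
  rw [Real.exp_neg, ← div_eq_mul_inv, div_le_iff₀ (Real.exp_pos _)]
  rwa [div_le_iff₀' hδ0] at h2

/-- A Chernoff bound for importance sampling of the summands of `c • ∑ i, H i` with
probabilities proportional to bounds `w i` on their norms. -/
theorem sum_prod_filter_lt_norm_importance_le {V ι : Type*} [NormedAddCommGroup V]
    [InnerProductSpace ℝ V] [FiniteDimensional ℝ V] [CompleteSpace V] [Nontrivial V] [Fintype ι]
    {H : ι → V →L[ℝ] V} (hH : ∀ i, IsSelfAdjoint (H i)) {w p : ι → ℝ} (hHw : ∀ i, ‖H i‖ ≤ w i)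
    (hpos : 0 < ∑ i, w i) (hpw : ∀ i, p i = w i / ∑ j, w j) {c : ℝ} (hc : 0 < c) {τ : ℝ}
    (hτ : 0 < τ) {s : ℕ} (hs : 0 < s) :
    ∑ k : Fin s → ι with
        τ < ‖(c * (s : ℝ)⁻¹) • ∑ j, (1 / p (k j)) • H (k j) - c • ∑ i, H i‖, ∏ j, p (k j) ≤
      2 * Module.finrank ℝ V * Real.exp (-(s * τ ^ 2 / (4 * (c * ∑ i, w i) ^ 2))) := by
  have hw0 : ∀ i, 0 ≤ w i := fun i => (norm_nonneg _).trans (hHw i)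
  have hp0 : ∀ i, 0 ≤ p i := fun i => by rw [hpw]; exact div_nonneg (hw0 i) hpos.le
  have hp1 : ∑ i, p i = 1 := by
    simp_rw [hpw]
    rw [← Finset.sum_div, div_self hpos.ne']
  have hXW : ∀ i, ‖(c * (1 / p i)) • H i‖ ≤ c * ∑ i, w i := by
    intro i
    have hcp : 0 ≤ c * (1 / p i) := mul_nonneg hc.le (one_div_nonneg.2 (hp0 i))
    rw [norm_smul, Real.norm_of_nonneg hcp]
    refine (mul_le_mul_of_nonneg_left (hHw i) hcp).trans ?_
    rcases (hw0 i).eq_or_lt with h | h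
    · rw [← h, mul_zero]
      positivity
    · rw [hpw]
      refine le_of_eq ?_
      field_simp
  have hmean : c • ∑ i, H i = ∑ i, p i • (c * (1 / p i)) • H i := by
    rw [Finset.smul_sum]
    refine Finset.sum_congr rfl fun i _ => ?_
    -- If `w i = 0` then `p i = 0` and `1 / p i` is `0` by convention; no mass is lost, since `H i =
    -- 0`.
    rcases (hw0 i).eq_or_lt with h | h
    · have h0 : H i = 0 := norm_le_zero_iff.1 (h ▸ hHw i)
      rw [h0, smul_zero, smul_zero, smul_zero]
    · have : p i ≠ 0 := by rw [hpw]; positivity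
      rw [smul_smul, mul_left_comm, mul_one_div_cancel this, mul_one]
  have hsub : ∀ k : Fin s → ι, (c * (s : ℝ)⁻¹) • ∑ j, (1 / p (k j)) • H (k j) =
      (s : ℝ)⁻¹ • ∑ j, (c * (1 / p (k j))) • H (k j) := by
    intro k
    rw [mul_comm, mul_smul, Finset.smul_sum]
    simp_rw [smul_smul]
  simp_rw [hsub, hmean]
  exact sum_prod_filter_lt_norm_le hp0 hp1 (fun i => (IsSelfAdjoint.all _).smul (hH i)) hXW hτ hs

theorem mainTheorem4 {N m n s : ℕ} (f : Fin N → ℝ → ℝ → ℝ)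
    (hf : ∀ i, ContDiff ℝ 2 (fun q : ℝ × ℝ => f i q.1 q.2))
    (a : Fin N → EuclideanSpace ℝ (Fin m)) (b : Fin N → EuclideanSpace ℝ (Fin n))
    (B : Fin N → ℝ) (hB : ∀ i x y, hessWeight (f i) (a i) (b i) x y ≤ B i)
    (Bavg : ℝ) (hBavg : Bavg = (1 / (N : ℝ)) * ∑ i, B i)
    (τ δ : ℝ) (hτ0 : 0 < τ) (hτ1 : τ < 1) (hδ0 : 0 < δ) (hδ1 : δ < 1)
    (x : EuclideanSpace ℝ (Fin m)) (y : EuclideanSpace ℝ (Fin n))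
    -- the sampling distribution at `(x, y)` is well defined
    (hpos : 0 < ∑ i, hessWeight (f i) (a i) (b i) x y)
    -- `ξ` is a sequence of `s` independent draws from this distribution
    {Ω : Type*} [MeasurableSpace Ω] (P : Measure Ω) [IsProbabilityMeasure P]
    (ξ : Fin s → Ω → Fin N) (hξ : ∀ j, Measurable (ξ j)) (hind : iIndepFun ξ P)
    (hlaw : ∀ j i, P.real {ω | ξ j ω = i} = samplingProb f a b x y i)
    (hs : 4 * Bavg ^ 2 / τ ^ 2 * Real.log (2 * ((m : ℝ) + (n : ℝ)) / δ) ≤ (s : ℝ)) :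
    1 - δ ≤ P.real {ω |
      ‖subsampledHessian f a b (samplingProb f a b x y) (fun j => ξ j ω) x y
        - fullHessian (finiteSum f a b) x y‖ ≤ τ} := by
  have hN : (0 : ℝ) < N := by
    rcases Nat.eq_zero_or_pos N with rfl | h
    · simp at hpos
    · exact_mod_cast h
  -- In dimension zero every weight vanishes, contradicting `hpos`.
  have hd : 1 ≤ m + n := by
    by_contra! hlt
    obtain ⟨rfl, rfl⟩ : m = 0 ∧ n = 0 := by omega
    refine hpos.ne' (Finset.sum_eq_zero fun i _ => ?_)
    simp [hessWeight, Subsingleton.elim (a i) 0, Subsingleton.elim (b i) 0]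
  have hfr : Module.finrank ℝ (WithLp 2 (EuclideanSpace ℝ (Fin m) × EuclideanSpace ℝ (Fin n)))
      = m + n := by
    rw [(WithLp.linearEquiv 2 ℝ _).finrank_eq, Module.finrank_prod, finrank_euclideanSpace_fin,
      finrank_euclideanSpace_fin]
  have : Nontrivial (WithLp 2 (EuclideanSpace ℝ (Fin m) × EuclideanSpace ℝ (Fin n))) :=
    Module.nontrivial_of_finrank_pos (R := ℝ) (by omega)
  have hW : 0 < 1 / (N : ℝ) * ∑ i, hessWeight (f i) (a i) (b i) x y := by positivity
  have hWB : 1 / (N : ℝ) * ∑ i, hessWeight (f i) (a i) (b i) x y ≤ Bavg := by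
    rw [hBavg]
    gcongr with i
    exact hB i x y
  obtain ⟨hs0, hfin⟩ := two_mul_exp_neg_le (d := (m : ℝ) + n) (by exact_mod_cast hd) hW hWB
    hτ0 hδ0 hδ1 hs
  have hbad := (measureReal_setOf_le_sum_prod hind hlaw _).trans
    (sum_prod_filter_lt_norm_importance_le
      (fun i => isSelfAdjoint_fullHessian_ridge (a i) (b i) x y (hf i))
      (fun i => norm_fullHessian_ridge_le (a i) (b i) x y (hf i)) hpos (fun i => rfl)
      (one_div_pos.2 hN) hτ0 (by exact_mod_cast hs0))
  rw [hfr, Nat.cast_add] at hbad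
  have hscale : 1 / ((N : ℝ) * s) = 1 / (N : ℝ) * (s : ℝ)⁻¹ := by
    rw [one_div, one_div, mul_inv]
  simp_rw [fullHessian_finiteSum hf, subsampledHessian, hscale]
  exact one_sub_le_measureReal_setOf_le (hbad.trans hfin)
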